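/- Let $\mathbb{F}_q$ be a finite field of order $q$ and characteristic $p$, and let $k\ge 2$. An arc in $\mathbb{F}_q^k$ is an ordered family of at least $k$ vectors in which every subfamily of size $k$ is a basis of $\mathbb{F}_q^k$; its size $|G|$ is the number of its members, and $g(k,q)$ denotes the maximum size of an arc in $\mathbb{F}_q^k$. For an arc $G\subset\mathbb{F}_q^k$, an integer $0\le n\le |G|-k+1$ and a basis $B$ of $\mathbb{F}_q^k$, let $M_G^{\uparrow n}$ be the matrix over $\mathbb{F}_q$ whose rows are indexed by the $(k-1)$-subsets $C$ of $G$, whose columns are indexed by the ordered pairs $(U,A)$ with $U\in\binom{G}{n}$ and $A\in\binom{G\setminus U}{k-2}$, and whose $(C,(U,A))$-entry is $\prod_{u\in U}\det(u,C)_B$ if $A\subset C\subset G\setminus U$, and $0$ otherwise. Here $\det(u,C)_B$ is the determinant of the $k\times k$ matrix whose first row is $u$ and whose last $k-1$ rows are the elements of $C$ in the order inherited from $G$, all written with respect to $B$. (1) If $k\le 2p-2\le q$ and $G\subset\mathbb{F}_q^k$ is an arc of size $2k-2$, then, for every choice of the basis $B$, the matrix $M_G^{\uparrow 1}$ has full row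 rank, that is, its rank is $\binom{2k-2}{k-1}$. (2) If $q$ is not prime and $k\le 2p-2$, then $g(k,q)=q+1$. -/

import Mathlib

/-- An ordered family `G` of at least `k` vectors of `F^k` is an arc if every subfamily of
size `k` is a basis of `F^k`. -/
def IsArc {F : Type*} [Field F] {k m : ℕ} (G : Fin m → (Fin k → F)) : Prop :=
  k ≤ m ∧ ∀ s : Finset (Fin m), s.card = k →
    LinearIndependent F (fun i : s => G i) ∧
      Submodule.span F (Set.range fun i : s => G i) = ⊤

/-- The set of all sizes of arcs in `F^k`. -/
def arcSizes (F : Type*) [Field F] (k : ℕ) : Set ℕ :=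
  {m | ∃ G : Fin m → (Fin k → F), IsArc G}

/-- Row indices: the subfamilies of `G` of size `k - 1`, given by their positions. -/
abbrev ArcRow (m k : ℕ) : Type :=
  {C : Finset (Fin m) // C.card + 1 = k}

/-- Column indices: pairs `(U, A)` of disjoint subfamilies of sizes `n` and `k - 2`. -/
abbrev ArcCol (m k n : ℕ) : Type :=
  {UA : Finset (Fin m) × Finset (Fin m) //
    UA.1.card = n ∧ UA.2.card + 2 = k ∧ Disjoint UA.1 UA.2}

/-- The family `(u, C)`: first `u`, then the vectors of `C` in the order inherited from `G`. -/
def consFamily {F : Type*} {k m : ℕ} (G : Fin m → (Fin k → F))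
    (u : Fin k → F) (C : ArcRow m k) : Fin k → (Fin k → F) :=
  fun i => (Fin.cons u (fun j => G (C.1.orderEmbOfFin rfl j)) :
    Fin (C.1.card + 1) → (Fin k → F)) (Fin.cast C.2.symm i)

/-- `det(u, C)_B`: the determinant of the matrix whose rows are `u` and then the vectors of
`C` in order, all written with respect to the basis `B`. -/
noncomputable def arcDet {F : Type*} [Field F] {k m : ℕ} (G : Fin m → (Fin k → F))
    (B : Module.Basis (Fin k) F (Fin k → F)) (u : Fin k → F) (C : ArcRow m k) : F :=
  (Matrix.of fun i j : Fin k => B.repr (consFamily G u C i) j).det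

/-- The matrix `M_G^{↑n}`, computed with respect to the basis `B`. -/
noncomputable def arcMatrix {F : Type*} [Field F] {k m : ℕ} (G : Fin m → (Fin k → F))
    (B : Module.Basis (Fin k) F (Fin k → F)) (n : ℕ) :
    Matrix (ArcRow m k) (ArcCol m k n) F :=
  Matrix.of fun C UA =>
    if UA.1.2 ⊆ C.1 ∧ Disjoint C.1 UA.1.1 then ∏ u ∈ UA.1.1, arcDet G B (G u) C else 0

/-! Write `k = n + 2`. In (1), a dependency `β` among the rows turns into linear forms `b C = β C •
det(·, C)` that vanish on `C`; the column `(u, A)` says that the values at `u` of the forms `b (A ∪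
{e})` sum to zero. For fixed `u`, take alternating sums of `C ↦ b C (G u)` over choices from `l`
disjoint pairs avoiding `u`. With `l = n + 1` there is no room for the pairs. Vanishing for `l + 1`
pairs means that members of `T` can be exchanged freely, and the column relation then gives `(n + 1
- l)` times the sum for `l` pairs equal to zero. This descends to `l = 0` except where `p` divides
`n + 1 - l`, which under `k ≤ 2p - 2` happens only when `n + 1 - l = p`. That step is bridged by
treating an alternating sum of the forms themselves as one form: it vanishes on `2p - 2 ≥ k` members
of the arc, so it is zero (`forms_eq_zero`).

In (2), an arc `S` of size `q + 2` would give any subarc `G` of size `2k - 2` a dependency with no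
zero coefficient, `β C` being the inverse of the product of `det(u, C)` over `S \ C` and over `G \
C`. Projecting from `A` reduces each column relation to an identity on the projective line, which is
Lagrange interpolation of a polynomial of too small a degree (`sum_inv_prod_sub_eq_zero`). This
contradicts (1); the normal rational curve attains `q + 1`. -/

/-! ### Alternating sums over disjoint pairs, and the descent. -/

section AlternatingSums

variable {α : Type*} [DecidableEq α] {M : Type*} [AddCommGroup M]

/-- The alternating sum of `g (T ∪ S)` over all `S` that pick one member from each pair of `L`. -/
def altSum (g : Finset α → M) : List (α × α) → Finset α → M
  | [], T => g T
  | (x, y) :: L, T => altSum g L (insert x T) - altSum g L (insert y T)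

/-- The set of all members of the pairs in `L`. -/
def pairSupport : List (α × α) → Finset α
  | [] => ∅
  | (x, y) :: L => insert x (insert y (pairSupport L))

/-- The members of the pairs in `L` are pairwise distinct and do not lie in `T`. -/
def DisjointPairs : List (α × α) → Finset α → Prop
  | [], _ => True
  | (x, y) :: L, T => x ≠ y ∧ x ∉ T ∧ y ∉ T ∧ x ∉ pairSupport L ∧ y ∉ pairSupport L ∧
      DisjointPairs L T

theorem DisjointPairs.card_pairSupport {L : List (α × α)} {T : Finset α}
    (h : DisjointPairs L T) : (pairSupport L).card = 2 * L.length := by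
  induction L with
  | nil => rfl
  | cons a L ih =>
    obtain ⟨x, y⟩ := a
    obtain ⟨hxy, -, -, hx, hy, h⟩ := h
    rw [pairSupport, Finset.card_insert_of_notMem (by simp [hxy, hx]),
      Finset.card_insert_of_notMem hy, ih h, List.length_cons]
    ring

theorem DisjointPairs.disjoint {L : List (α × α)} {T : Finset α}
    (h : DisjointPairs L T) : Disjoint T (pairSupport L) := by
  induction L with
  | nil => simp [pairSupport]
  | cons a L ih =>
    obtain ⟨x, y⟩ := a
    obtain ⟨-, hx, hy, -, -, h⟩ := h
    simp [pairSupport, hx, hy, ih h]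

theorem DisjointPairs.insert {L : List (α × α)} {T : Finset α} {z : α}
    (h : DisjointPairs L T) (hz : z ∉ pairSupport L) : DisjointPairs L (insert z T) := by
  induction L with
  | nil => trivial
  | cons a L ih =>
    obtain ⟨x, y⟩ := a
    obtain ⟨hxy, hx, hy, hx', hy', h⟩ := h
    simp only [pairSupport, Finset.mem_insert, not_or] at hz
    exact ⟨hxy, by simp [hx, Ne.symm hz.1], by simp [hy, Ne.symm hz.2.1], hx', hy',
      ih h hz.2.2⟩

theorem DisjointPairs.mono {L : List (α × α)} {S T : Finset α}
    (h : DisjointPairs L T) (hS : S ⊆ T) : DisjointPairs L S := by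
  induction L with
  | nil => trivial
  | cons a L ih =>
    obtain ⟨x, y⟩ := a
    obtain ⟨hxy, hx, hy, hx', hy', h⟩ := h
    exact ⟨hxy, fun h' => hx (hS h'), fun h' => hy (hS h'), hx', hy', ih h⟩

theorem altSum_eq_zero_of_mem {g : Finset α → M} {w : α} (hg : ∀ C, w ∈ C → g C = 0)
    (L : List (α × α)) {T : Finset α} (hw : w ∈ T) : altSum g L T = 0 := by
  induction L generalizing T with
  | nil => exact hg T hw
  | cons a L ih =>
    rw [altSum, ih (Finset.mem_insert_of_mem hw), ih (Finset.mem_insert_of_mem hw), sub_zero]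

theorem map_altSum {M' : Type*} [AddCommGroup M'] (f : M →+ M') (g : Finset α → M)
    (L : List (α × α)) (T : Finset α) :
    f (altSum g L T) = altSum (fun C => f (g C)) L T := by
  induction L generalizing T with
  | nil => rfl
  | cons a L ih => rw [altSum, altSum, map_sub, ih, ih]

/-- If `g` sums to zero over all one-element extensions of every `n`-set, then so do its
alternating sums. -/
theorem sum_altSum_eq_zero {g : Finset α → M} {N : Finset α} {n : ℕ}
    (hg : ∀ A ⊆ N, A.card = n → ∑ x ∈ N \ A, g (insert x A) = 0)
    (L : List (α × α)) (T : Finset α) (hLT : DisjointPairs L T) (hT : T ⊆ N)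
    (hL : pairSupport L ⊆ N) (hcard : T.card + L.length = n) :
    ∑ r ∈ N \ (T ∪ pairSupport L), altSum g L (insert r T) = 0 := by
  induction L generalizing T with
  | nil => simpa [altSum, pairSupport] using hg T hT hcard
  | cons a L ih =>
    obtain ⟨x, y⟩ := a
    obtain ⟨hxy, hx, hy, hx', hy', h⟩ := hLT
    simp only [pairSupport, Finset.insert_subset_iff] at hL
    -- The relation for `insert x T` also has the term `r = y`. Moved to the right, it is symmetric
    -- in `x` and `y`, so it cancels in the difference.
    have key : ∀ x y : α, x ≠ y → x ∉ T → y ∉ T → x ∉ pairSupport L → y ∉ pairSupport L →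
        x ∈ N → y ∈ N →
        ∑ r ∈ N \ (T ∪ insert x (insert y (pairSupport L))), altSum g L (insert x (insert r T)) =
          - altSum g L (insert x (insert y T)) := by
      intro x y hxy hx hy hx' hy' hxN hyN
      have h1 := ih (insert x T) (h.insert hx') (Finset.insert_subset hxN hT) hL.2.2
        (by rw [Finset.card_insert_of_notMem hx]; simp at hcard; omega)
      have h2 : N \ (insert x T ∪ pairSupport L) =
          insert y (N \ (T ∪ insert x (insert y (pairSupport L)))) := by
        ext z
        simp only [Finset.mem_sdiff, Finset.mem_union, Finset.mem_insert]
        by_cases hzy : z = y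
        · subst hzy; simp [hyN, Ne.symm hxy, hy, hy']
        · simp only [hzy, false_or]; tauto
      rw [h2, Finset.sum_insert (by simp)] at h1
      rw [eq_neg_iff_add_eq_zero, add_comm, Finset.insert_comm x y]
      simpa only [Finset.insert_comm x] using h1
    have h1 := key x y hxy hx hy hx' hy' hL.1 hL.2.1
    have h2 := key y x hxy.symm hy hx hy' hx' hL.2.1 hL.1
    simp only [pairSupport, altSum, Finset.sum_sub_distrib]
    rw [h1, Finset.insert_comm x y (pairSupport L), h2, Finset.insert_comm x y T, sub_self]

/-- Descent: if all alternating sums over `l + 1` pairs vanish, then so do those over `l` pairs,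
provided `n + 1 - l` is invertible. -/
theorem altSum_eq_zero_of_succ {F : Type*} [Field F] {g : Finset α → F} {N : Finset α} {n l : ℕ}
    (hg : ∀ A ⊆ N, A.card = n → ∑ x ∈ N \ A, g (insert x A) = 0)
    (hN : N.card = 2 * n + 1) (hl : l ≤ n) (hF : ((n + 1 - l : ℕ) : F) ≠ 0)
    (hsucc : ∀ (L : List (α × α)) (T : Finset α), L.length = l + 1 → T.card + (l + 1) = n + 1 →
      DisjointPairs L T → T ⊆ N → pairSupport L ⊆ N → altSum g L T = 0)
    (L : List (α × α)) (T : Finset α) (hLl : L.length = l) (hTl : T.card + l = n + 1)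
    (hLT : DisjointPairs L T) (hT : T ⊆ N) (hL : pairSupport L ⊆ N) : altSum g L T = 0 := by
  obtain ⟨x, hx⟩ : T.Nonempty := by rw [← Finset.card_pos]; omega
  have hxL : x ∉ pairSupport L := Finset.disjoint_left.1 hLT.disjoint hx
  have hT0 : DisjointPairs L (T.erase x) := hLT.mono (T.erase_subset x)
  have hT0N : T.erase x ⊆ N := (T.erase_subset x).trans hT
  have hc : (T.erase x).card + 1 = T.card := Finset.card_erase_add_one hx
  have hsum := sum_altSum_eq_zero hg L (T.erase x) hT0 hT0N hL (by omega)
  -- Exchanging `x` for `r` changes the sum by the alternating sum with the extra pair `(x, r)`,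
  -- which is zero.
  have hconst : ∀ r ∈ N \ (T.erase x ∪ pairSupport L),
      altSum g L (insert r (T.erase x)) = altSum g L T := by
    intro r hr
    simp only [Finset.mem_sdiff, Finset.mem_union, not_or] at hr
    by_cases hrx : r = x
    · rw [hrx, Finset.insert_erase hx]
    · have := hsucc ((x, r) :: L) (T.erase x) (by simp [hLl]) (by omega)
        ⟨Ne.symm hrx, by simp, hr.2.1, hxL, hr.2.2, hT0⟩ hT0N
        (Finset.insert_subset (hT hx) (Finset.insert_subset hr.1 hL))
      rw [altSum, Finset.insert_erase hx, sub_eq_zero] at this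
      exact this.symm
  rw [Finset.sum_congr rfl hconst, Finset.sum_const, nsmul_eq_mul] at hsum
  have hcard : (N \ (T.erase x ∪ pairSupport L)).card = n + 1 - l := by
    rw [Finset.card_sdiff_of_subset (Finset.union_subset hT0N hL),
      Finset.card_union_of_disjoint hT0.disjoint, hT0.card_pairSupport]
    omega
  rw [hcard] at hsum
  exact (mul_eq_zero.1 hsum).resolve_left hF

/-- Linear forms `b C`, indexed by the `(n + 1)`-subsets of a family `G` of `2 n + 2` vectors,
such that `b C` vanishes on `C` and the sum of the `b C` over all `C` containing a given `n`-set
vanishes, are zero if a form that vanishes on `n + 2` members of `G` is zero and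
`n + 2 ≤ 2 p - 2`. -/
theorem forms_eq_zero {F V : Type*} [Field F] [AddCommGroup V] [Module F V] [Fintype α]
    {p n : ℕ} [CharP F p] (hnp : n + 2 ≤ 2 * p - 2)
    (hα : Fintype.card α = 2 * n + 2) (G : α → V) (b : Finset α → V →ₗ[F] F)
    (hb : ∀ C, ∀ u ∈ C, b C (G u) = 0)
    (hsum : ∀ (A : Finset α) (u : α), A.card = n → u ∉ A →
      ∑ e ∈ Finset.univ.erase u \ A, b (insert e A) (G u) = 0)
    (hvan : ∀ (φ : V →ₗ[F] F) (s : Finset α), n + 2 ≤ s.card → (∀ i ∈ s, φ (G i) = 0) → φ = 0)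
    (C : Finset α) (u : α) (hC : C.card = n + 1) (hu : u ∉ C) : b C (G u) = 0 := by
  have hN : ∀ u : α, (Finset.univ.erase u).card = 2 * n + 1 := fun u => by
    rw [Finset.card_erase_of_mem (Finset.mem_univ u), Finset.card_univ, hα]; omega
  have hg : ∀ u : α, ∀ A ⊆ Finset.univ.erase u, A.card = n →
      ∑ x ∈ Finset.univ.erase u \ A, b (insert x A) (G u) = 0 := fun u A hA hc =>
    hsum A u hc fun h => by simpa using hA h
  -- Here `j` is `n + 1` minus the number of pairs. For `j = 0` the pairs would need `2n + 2` points
  -- out of `2n + 1`. The induction runs over all `u` at once because the exceptional step uses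
  -- other evaluation points.
  have main : ∀ j ≤ n + 1, ∀ (u : α) (L : List (α × α)) (T : Finset α),
      L.length = n + 1 - j → T.card + (n + 1 - j) = n + 1 → DisjointPairs L T →
      T ⊆ Finset.univ.erase u → pairSupport L ⊆ Finset.univ.erase u →
      altSum (fun C => b C (G u)) L T = 0 := by
    intro j
    induction j with
    | zero =>
      intro _ u L T hL _ hLT _ hLN
      have := Finset.card_le_card hLN
      rw [hLT.card_pairSupport, hN] at this
      omega
    | succ j ih =>
      intro hj u
      have ih := ih (by omega)
      have hj1 : n + 1 - j = n + 1 - (j + 1) + 1 := by omega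
      rw [hj1] at ih
      by_cases hF : ((n + 1 - (n + 1 - (j + 1)) : ℕ) : F) = 0
      · rw [CharP.cast_eq_zero_iff F p] at hF
        have hjp : j + 1 = p := by
          obtain ⟨c, hc⟩ := hF
          have hc' : j + 1 = p * c := by omega
          have : c = 1 := by
            rcases c with _ | _ | c
            · omega
            · rfl
            · have : p * (c + 1 + 1) = p * c + 2 * p := by ring
              omega
          rw [hc', this, mul_one]
        intro L T hLl hTl hLT hT hL
        obtain ⟨y, hy⟩ : T.Nonempty := by rw [← Finset.card_pos]; omega
        have hyL : y ∉ pairSupport L := Finset.disjoint_left.1 hLT.disjoint hy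
        have hyu : u ≠ y := fun h => by simpa [h] using hT hy
        have huT : u ∉ T := fun h => by simpa using hT h
        have huL : u ∉ pairSupport L := fun h => by simpa using hL h
        have hT0 : DisjointPairs L (T.erase y) := hLT.mono (T.erase_subset y)
        have hP : DisjointPairs ((u, y) :: L) (T.erase y) :=
          ⟨hyu, by simp [huT], by simp, huL, hyL, hT0⟩
        have hc : (T.erase y).card + 1 = T.card := Finset.card_erase_add_one hy
        have heval : ∀ w, altSum b ((u, y) :: L) (T.erase y) (G w) =
            altSum (fun C => b C (G w)) ((u, y) :: L) (T.erase y) := fun w =>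
          map_altSum (AddMonoidHom.mk' (fun f : V →ₗ[F] F => f (G w)) fun _ _ => rfl) b
            ((u, y) :: L) (T.erase y)
        -- Now `L.length = n + 1 - p`, so `2p - 2 ≥ n + 2` points lie outside the pairs of `(u, y)
        -- :: L`. The form vanishes at those in `T.erase y` since they lie in every `C`, and at the
        -- others by induction.
        have hφ : altSum b ((u, y) :: L) (T.erase y) = 0 := by
          refine hvan _ (Finset.univ \ pairSupport ((u, y) :: L)) ?_ ?_
          · rw [Finset.card_sdiff_of_subset (Finset.subset_univ _), hP.card_pairSupport,
              Finset.card_univ, hα, List.length_cons]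
            omega
          · intro w hw
            rw [heval]
            by_cases hwT : w ∈ T.erase y
            · exact altSum_eq_zero_of_mem (fun C hC => hb C w hC) _ hwT
            · refine ih w _ _ (by simp [hLl]) (by omega) hP ?_ ?_
              · exact fun z hz => Finset.mem_erase.2 ⟨fun h => hwT (h ▸ hz), Finset.mem_univ _⟩
              · exact fun z hz => Finset.mem_erase.2
                  ⟨fun h => (Finset.mem_sdiff.1 hw).2 (h ▸ hz), Finset.mem_univ _⟩
        -- At `u` the half of the sum whose sets contain `u` vanishes, leaving minus the wanted sum.
        have h0 := heval u
        rw [hφ, LinearMap.zero_apply, altSum, Finset.insert_erase hy,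
          altSum_eq_zero_of_mem (fun C hC => hb C u hC) L (Finset.mem_insert_self u _),
          zero_sub] at h0
        exact neg_eq_zero.1 h0.symm
      · exact altSum_eq_zero_of_succ (hg u) (hN u) (by omega) hF (ih u)
  have := main (n + 1) le_rfl u [] C (by simp) (by omega) trivial
    (fun z hz => Finset.mem_erase.2 ⟨fun h => hu (h ▸ hz), Finset.mem_univ _⟩)
    (by simp [pairSupport])
  exact this

end AlternatingSums

/-! ### Determinants on arcs, and full row rank. -/

section Arcs

variable {F : Type*} [Field F]

theorem IsArc.span_range_comp {k m : ℕ} {G : Fin m → Fin k → F} (hG : IsArc G)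
    {f : Fin k → Fin m} (hf : Function.Injective f) :
    LinearIndependent F (G ∘ f) ∧ Submodule.span F (Set.range (G ∘ f)) = ⊤ := by
  have hs := (hG.2 (Finset.univ.image f)
    (by rw [Finset.card_image_of_injective _ hf, Finset.card_univ, Fintype.card_fin])).1
  have hli : LinearIndependent F (G ∘ f) :=
    hs.comp (fun i => ⟨f i, Finset.mem_image_of_mem f (Finset.mem_univ i)⟩)
      fun i j h => hf (Subtype.ext_iff.1 h)
  exact ⟨hli, hli.span_eq_top_of_card_eq_finrank' (by simp)⟩

theorem IsArc.det_ne_zero {k m : ℕ} {G : Fin m → Fin k → F} (hG : IsArc G)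
    (B : Module.Basis (Fin k) F (Fin k → F)) {f : Fin k → Fin m} (hf : Function.Injective f) :
    B.det (G ∘ f) ≠ 0 :=
  (B.is_basis_iff_det.1 (hG.span_range_comp hf)).ne_zero

theorem IsArc.form_eq_zero {k m : ℕ} {G : Fin m → Fin k → F} (hG : IsArc G)
    (φ : (Fin k → F) →ₗ[F] F) (s : Finset (Fin m)) (hs : k ≤ s.card)
    (hφ : ∀ i ∈ s, φ (G i) = 0) : φ = 0 := by
  obtain ⟨t, hts, ht⟩ := Finset.exists_subset_card_eq hs
  refine LinearMap.ext_on_range (hG.2 t ht).2 fun i => ?_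
  simpa using hφ i (hts i.2)

theorem IsArc.comp {k m m' : ℕ} {G : Fin m → Fin k → F} (hG : IsArc G) (hk : k ≤ m')
    {ι : Fin m' → Fin m} (hι : Function.Injective ι) : IsArc (G ∘ ι) := by
  refine ⟨hk, fun s hs => ?_⟩
  have hli : LinearIndependent F (fun i : s => (G ∘ ι) i) := by
    refine (hG.2 (s.image ι) (by rw [Finset.card_image_of_injective _ hι, hs])).1.comp
      (fun i : s => ⟨ι i, Finset.mem_image_of_mem ι i.2⟩) fun i j h => ?_
    exact Subtype.ext (hι (Subtype.ext_iff.1 h))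
  exact ⟨hli, hli.span_eq_top_of_card_eq_finrank' (by simp [hs])⟩

theorem consFamily_succ {F : Type*} {n m : ℕ} (G : Fin m → Fin (n + 1) → F) (u : Fin (n + 1) → F)
    (C : ArcRow m (n + 1)) :
    consFamily G u C =
      Fin.cons u (fun j => G (C.1.orderEmbOfFin (Nat.succ_injective C.2) j)) := by
  obtain ⟨C, hC⟩ := C
  obtain rfl : C.card = n := Nat.succ_injective hC
  rfl

theorem arcDet_eq_det {k m : ℕ} (G : Fin m → Fin k → F)
    (B : Module.Basis (Fin k) F (Fin k → F)) (u : Fin k → F) (C : ArcRow m k) :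
    arcDet G B u C = B.det (consFamily G u C) := by
  rw [Module.Basis.det_apply, ← Matrix.det_transpose]
  rfl

theorem exists_linearMap_eq_arcDet {n m : ℕ} (G : Fin m → Fin (n + 1) → F)
    (B : Module.Basis (Fin (n + 1)) F (Fin (n + 1) → F)) (C : ArcRow m (n + 1)) :
    ∃ φ : (Fin (n + 1) → F) →ₗ[F] F, ∀ u, φ u = arcDet G B u C := by
  refine ⟨B.det.toMultilinearMap.toLinearMap (consFamily G 0 C) 0, fun u => ?_⟩
  rw [arcDet_eq_det, consFamily_succ, consFamily_succ, MultilinearMap.toLinearMap_apply,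
    Fin.update_cons_zero]
  rfl

theorem arcDet_eq_zero {n m : ℕ} (G : Fin m → Fin (n + 1) → F)
    (B : Module.Basis (Fin (n + 1)) F (Fin (n + 1) → F)) (C : ArcRow m (n + 1)) {u : Fin m}
    (hu : u ∈ C.1) : arcDet G B (G u) C = 0 := by
  rw [arcDet_eq_det, consFamily_succ]
  obtain ⟨j, hj⟩ : u ∈ Set.range (C.1.orderEmbOfFin (Nat.succ_injective C.2)) := by
    simpa using hu
  refine B.det.map_eq_zero_of_eq _ (i := 0) (j := j.succ) ?_ (Fin.succ_ne_zero j).symm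
  simp [hj]

/-- Up to a sign, `det(u, C)` may be computed with respect to any ordering of `C`. -/
theorem exists_sign_arcDet {n m : ℕ} (G : Fin m → Fin (n + 1) → F)
    (B : Module.Basis (Fin (n + 1)) F (Fin (n + 1) → F)) (C : ArcRow m (n + 1))
    {f : Fin n → Fin m} (hf : Function.Injective f) (hfC : ∀ i, f i ∈ C.1) :
    ∃ ε : F, ε ^ 2 = 1 ∧ ∀ u, B.det (Fin.cons u (G ∘ f)) = ε * arcDet G B u C := by
  have hC : C.1.card = n := Nat.succ_injective C.2
  have hbij : Function.Bijective (fun i => (⟨f i, hfC i⟩ : C.1)) :=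
    (Fintype.bijective_iff_injective_and_card _).2
      ⟨fun i j h => hf (Subtype.ext_iff.1 h), by simp [hC]⟩
  let σ : Equiv.Perm (Fin n) :=
    (Equiv.ofBijective _ hbij).trans (C.1.orderIsoOfFin hC).symm.toEquiv
  have hσ : ∀ i, C.1.orderEmbOfFin hC (σ i) = f i := fun i => by
    rw [← Finset.coe_orderIsoOfFin_apply]
    simp [σ]
  refine ⟨((Equiv.Perm.sign σ : ℤ) : F), ?_, fun u => ?_⟩
  · rw [← Int.cast_pow, ← Units.val_pow_eq_pow_val, Int.units_sq]
    simp
  · rw [arcDet_eq_det, consFamily_succ]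
    have h := (B.det.curryLeft u).map_perm (fun j => G (C.1.orderEmbOfFin hC j)) σ
    have h2 : (fun j => G (C.1.orderEmbOfFin hC j)) ∘ σ = G ∘ f := by
      funext i; simp [hσ]
    rw [h2] at h
    simpa [AlternatingMap.curryLeft_apply_apply, Matrix.vecCons, Units.smul_def] using h

theorem IsArc.arcDet_ne_zero {n m m' : ℕ} {S : Fin m → Fin (n + 1) → F} (hS : IsArc S)
    {ι : Fin m' → Fin m} (hι : Function.Injective ι)
    (B : Module.Basis (Fin (n + 1)) F (Fin (n + 1) → F)) (C : ArcRow m' (n + 1)) {u : Fin m}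
    (hu : ∀ c ∈ C.1, ι c ≠ u) : arcDet (S ∘ ι) B (S u) C ≠ 0 := by
  rw [arcDet_eq_det, consFamily_succ]
  have hinj : Function.Injective (Fin.cons u
      (fun j => ι (C.1.orderEmbOfFin (Nat.succ_injective C.2) j)) : Fin (n + 1) → Fin m) := by
    rw [Fin.cons_injective_iff]
    refine ⟨?_, hι.comp (RelEmbedding.injective _)⟩
    rintro ⟨j, hj⟩
    exact hu _ (Finset.orderEmbOfFin_mem _ _ j) hj
  convert hS.det_ne_zero B hinj using 2
  funext i
  refine Fin.cases ?_ (fun j => ?_) i <;> simp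

/-- The sum over the rows that meet a column of the arc matrix, indexed by single elements. -/
theorem sum_arcRow_eq {m k : ℕ} (f : Finset (Fin m) → F) {U A : Finset (Fin m)}
    (hA : A.card + 2 = k) (hUA : Disjoint U A) :
    (∑ C : ArcRow m k, if A ⊆ C.1 ∧ Disjoint C.1 U then f C.1 else 0) =
      ∑ e ∈ Finset.univ \ (U ∪ A), f (insert e A) := by
  rw [← Finset.sum_subtype (Finset.univ.filter fun C : Finset (Fin m) => C.card + 1 = k)
    (by simp) (fun C => if A ⊆ C ∧ Disjoint C U then f C else 0), ← Finset.sum_filter]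
  symm
  refine Finset.sum_bij (fun e _ => insert e A) ?_ ?_ ?_ ?_
  · intro e he
    simp only [Finset.mem_sdiff, Finset.mem_univ, Finset.mem_union, not_or, true_and] at he
    simp [he.1, he.2, hUA.symm, hA]
  · intro e he e' he' h
    simp only [Finset.mem_sdiff, Finset.mem_univ, Finset.mem_union, not_or, true_and] at he he'
    exact ((Finset.mem_insert.1 (h ▸ Finset.mem_insert_self e A)).resolve_right he.2)
  · intro C hC
    simp only [Finset.mem_filter, Finset.mem_univ, true_and] at hC
    obtain ⟨hC, hAC, hCU⟩ := hC
    have h1 : (C \ A).card = 1 := by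
      rw [Finset.card_sdiff_of_subset hAC]; omega
    obtain ⟨e, he⟩ := Finset.card_eq_one.1 h1
    have heC : e ∈ C \ A := he ▸ Finset.mem_singleton_self e
    rw [Finset.mem_sdiff] at heC
    refine ⟨e, ?_, ?_⟩
    · simp [heC.2, Finset.disjoint_left.1 hCU heC.1]
    · rw [Finset.insert_eq, ← he, Finset.sdiff_union_of_subset hAC]
  · intros; rfl

/-- The rows of `M_G^{↑1}` are linearly independent for an arc `G` of size `2 k - 2` if
`k ≤ 2 p - 2`. -/
theorem IsArc.vecMul_arcMatrix_eq_zero {p n : ℕ} [CharP F p] (hnp : n + 2 ≤ 2 * p - 2)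
    {G : Fin (2 * (n + 2) - 2) → Fin (n + 2) → F} (hG : IsArc G)
    (B : Module.Basis (Fin (n + 2)) F (Fin (n + 2) → F))
    (β : ArcRow (2 * (n + 2) - 2) (n + 2) → F) (hβ : Matrix.vecMul β (arcMatrix G B 1) = 0) :
    β = 0 := by
  choose φ hφ using exists_linearMap_eq_arcDet G B
  let b : Finset (Fin (2 * (n + 2) - 2)) → (Fin (n + 2) → F) →ₗ[F] F := fun C =>
    if h : C.card + 1 = n + 2 then β ⟨C, h⟩ • φ ⟨C, h⟩ else 0
  have hb : ∀ (C : ArcRow (2 * (n + 2) - 2) (n + 2)) (v : Fin (n + 2) → F),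
      b C.1 v = β C * arcDet G B v C := fun C v => by
    have : b C.1 = β C • φ C := dif_pos C.2
    rw [this, LinearMap.smul_apply, hφ, smul_eq_mul]
  have hbG : ∀ C, C.card = n + 1 → ∀ u ∉ C, b C (G u) = 0 := by
    intro C hC u hu
    refine forms_eq_zero (p := p) hnp (by simp; omega) G b ?_ ?_
      (fun φ s hs h => hG.form_eq_zero φ s hs h) C u hC hu
    · intro C u hu
      by_cases h : C.card + 1 = n + 2
      · rw [hb ⟨C, h⟩, arcDet_eq_zero G B ⟨C, h⟩ hu, mul_zero]
      · rw [show b C = 0 from dif_neg h, LinearMap.zero_apply]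
    · intro A u hA hu
      have hcol := congrFun hβ ⟨({u}, A), by simp, by simp [hA], by simpa using hu⟩
      rw [Matrix.vecMul, dotProduct, Pi.zero_apply] at hcol
      have := sum_arcRow_eq (k := n + 2) (fun C => b C (G u)) (U := {u}) (A := A) (by omega)
        (by simpa using hu)
      have hset : Finset.univ.erase u \ A = Finset.univ \ ({u} ∪ A) := by
        ext z; simp
      rw [hset, ← this]
      refine Eq.trans ?_ hcol
      refine Finset.sum_congr rfl fun C _ => ?_
      simp only [arcMatrix, Matrix.of_apply, Finset.prod_singleton, mul_ite, mul_zero, hb]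
  funext C
  have hC : C.1.card = n + 1 := Nat.succ_injective C.2
  obtain ⟨u, hu⟩ : ∃ u, u ∉ C.1 := by
    by_contra! h
    have := Finset.card_le_card (fun u _ => h u : Finset.univ ⊆ C.1)
    rw [Finset.card_univ, Fintype.card_fin, hC] at this
    omega
  have h0 := hbG C.1 hC u hu
  rw [hb] at h0
  exact (mul_eq_zero.1 h0).resolve_right
    (hG.arcDet_ne_zero Function.injective_id B C fun c hc h => hu (h ▸ hc))

end Arcs

/-! ### Interpolation identities behind the column relations. -/

section Tangents

variable {F : Type*} [Field F] [Fintype F]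

open Polynomial in
/-- The leading coefficient of an interpolating polynomial of too small a degree vanishes; here
the polynomial has the elements of `F` outside the image of `Y` as its roots. -/
theorem sum_inv_prod_sub_eq_zero {ι : Type*} [DecidableEq ι] {Y E : Finset ι} (hE : E ⊆ Y)
    {x : ι → F} (hx : Set.InjOn x Y) (hcard : Y.card + E.card = Fintype.card F + 2) :
    ∑ e ∈ E, (∏ u ∈ Y.erase e, (x e - x u))⁻¹ * (∏ u ∈ E.erase e, (x e - x u))⁻¹ = 0 := by
  classical
  let P : F[X] := ∏ w ∈ Finset.univ \ Y.image x, (X - C w)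
  let κ : F := ∏ v ∈ Finset.univ.erase (0 : F), v
  have hκ : κ ≠ 0 := Finset.prod_ne_zero_iff.2 fun v hv => (Finset.mem_erase.1 hv).1
  have himage : (Y.image x).card = Y.card := Finset.card_image_of_injOn hx
  have hY : Y.card ≤ Fintype.card F := himage ▸ Finset.card_le_univ _
  have hdeg : P.natDegree + Y.card = Fintype.card F := by
    rw [natDegree_finsetProd_X_sub_C_eq_card, Finset.card_sdiff_of_subset (Finset.subset_univ _),
      himage, Finset.card_univ]
    omega
  -- The differences `x e - w` over all `w ≠ x e` multiply to `κ`, independently of `e`; the factors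
  -- with `w` outside the image of `Y` give `P.eval (x e)`.
  have hterm : ∀ e ∈ E, (∏ u ∈ Y.erase e, (x e - x u))⁻¹ = κ⁻¹ * P.eval (x e) := by
    intro e he
    have hall : ∏ w ∈ Finset.univ.erase (x e), (x e - w) = κ := by
      refine Finset.prod_bij (fun w _ => x e - w) ?_ ?_ ?_ ?_
      · intro w hw
        simpa [sub_eq_zero, eq_comm] using hw
      · intro w _ w' _ h
        simpa using h
      · intro v hv
        exact ⟨x e - v, by simpa using hv, by simp⟩
      · intros; rfl
    have hsplit : Finset.univ.erase (x e) = (Y.erase e).image x ∪ (Finset.univ \ Y.image x) := by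
      ext w
      simp only [Finset.mem_erase, Finset.mem_univ, and_true, Finset.mem_union, Finset.mem_image,
        Finset.mem_sdiff, true_and, not_exists, not_and]
      constructor
      · intro hw
        by_cases h : ∃ u ∈ Y, x u = w
        · obtain ⟨u, hu, rfl⟩ := h
          exact Or.inl ⟨u, ⟨fun h => hw (h ▸ rfl), hu⟩, rfl⟩
        · exact Or.inr fun u hu h' => h ⟨u, hu, h'⟩
      · rintro (⟨u, ⟨hue, hu⟩, rfl⟩ | h) h'
        · exact hue (hx hu (hE he) h')
        · exact h e (hE he) h'.symm
    have hdisj : Disjoint ((Y.erase e).image x) (Finset.univ \ Y.image x) :=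
      Finset.disjoint_sdiff.mono_left (Finset.image_subset_image (Y.erase_subset e))
    rw [hsplit, Finset.prod_union hdisj, Finset.prod_image
      (hx.mono (by simp))] at hall
    have hP : P.eval (x e) = ∏ w ∈ Finset.univ \ Y.image x, (x e - w) := by
      simp [P, eval_prod]
    rw [← hP] at hall
    have h0 : ∏ u ∈ Y.erase e, (x e - x u) ≠ 0 := fun h => hκ (by rw [← hall, h, zero_mul])
    rw [← hall] at hκ ⊢
    have h1 := right_ne_zero_of_mul hκ
    field_simp
  have hEcard : 2 ≤ E.card := by omega
  have hPdeg : P.degree < E.card :=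
    lt_of_le_of_lt degree_le_natDegree (by exact_mod_cast (by omega))
  -- This is the coefficient in degree `E.card - 1`, whereas `P` has degree `E.card - 2`.
  have hcoeff := Lagrange.coeff_eq_sum (hx.mono (by exact_mod_cast hE)) hPdeg
  rw [coeff_eq_zero_of_natDegree_lt (by omega)] at hcoeff
  calc _ = ∑ e ∈ E, κ⁻¹ * (P.eval (x e) / ∏ u ∈ E.erase e, (x e - x u)) :=
        Finset.sum_congr rfl fun e he => by rw [hterm e he, div_eq_mul_inv, mul_assoc]
    _ = 0 := by rw [← Finset.mul_sum, ← hcoeff, mul_zero]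

/-- The homogeneous form of `sum_inv_prod_sub_eq_zero`. -/
theorem sum_inv_prod_scaled_eq_zero {ι : Type*} [DecidableEq ι] {Y E : Finset ι} (hE : E ⊆ Y)
    {x s : ι → F} {c : F} (hs : ∀ e ∈ Y, s e ≠ 0) (hx : Set.InjOn x Y)
    (hcard : Y.card + E.card = Fintype.card F + 2) :
    ∑ e ∈ E, (s e * ∏ u ∈ Y.erase e, (c * s u * s e * (x e - x u)))⁻¹ *
      (∏ u ∈ E.erase e, (c * s u * s e * (x e - x u)))⁻¹ = 0 := by
  have hprod : ∀ Z : Finset ι, ∀ e ∈ Z, (∏ u ∈ Z.erase e, (c * s u * s e * (x e - x u))) * s e =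
      (c * s e) ^ (Z.card - 1) * (∏ u ∈ Z, s u) * ∏ u ∈ Z.erase e, (x e - x u) := by
    intro Z e he
    rw [← Finset.prod_erase_mul Z s he, ← Finset.card_erase_of_mem he, ← Finset.prod_const]
    simp only [Finset.prod_mul_distrib]
    ring
  let K : F := c ^ Fintype.card F * (∏ u ∈ Y, s u) * ∏ u ∈ E, s u
  calc _ = ∑ e ∈ E, K⁻¹ *
        ((∏ u ∈ Y.erase e, (x e - x u))⁻¹ * (∏ u ∈ E.erase e, (x e - x u))⁻¹) := by
        refine Finset.sum_congr rfl fun e he => ?_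
        have hse := hs e (hE he)
        simp only [← mul_inv]
        congr 1
        have h1 := hprod Y e (hE he)
        have h2 := hprod E e he
        have hYpos : 0 < Y.card := Finset.card_pos.2 ⟨e, hE he⟩
        have hEpos : 0 < E.card := Finset.card_pos.2 ⟨e, he⟩
        -- The exponents add up to `q`, and `s e ^ q = s e`; hence the scaling factor `K` does not
        -- depend on `e`.
        have hpow : (c * s e) ^ (Y.card - 1) * (c * s e) ^ (E.card - 1) =
            c ^ Fintype.card F * s e := by
          rw [← pow_add, show Y.card - 1 + (E.card - 1) = Fintype.card F by omega, mul_pow,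
            FiniteField.pow_card (s e)]
        apply mul_right_cancel₀ hse
        calc _ = ((∏ u ∈ Y.erase e, (c * s u * s e * (x e - x u))) * s e) *
              ((∏ u ∈ E.erase e, (c * s u * s e * (x e - x u))) * s e) := by ring
          _ = ((c * s e) ^ (Y.card - 1) * (c * s e) ^ (E.card - 1)) * (∏ u ∈ Y, s u) *
              (∏ u ∈ E, s u) * ((∏ u ∈ Y.erase e, (x e - x u)) *
                ∏ u ∈ E.erase e, (x e - x u)) := by rw [h1, h2]; ring
          _ = _ := by rw [hpow]; ring
    _ = 0 := by rw [← Finset.mul_sum, sum_inv_prod_sub_eq_zero hE hx hcard, mul_zero]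

/-- Fixing the vectors `S ∘ a` makes the determinant an alternating form `φ` in two variables, that
is, a projection to a line. With `z` at infinity, the other points have affine coordinates `x` and
scale factors `s`, and the scaled interpolation identity applies. -/
theorem IsArc.sum_inv_prod_det_eq_zero {n m : ℕ} {S : Fin m → Fin (n + 2) → F} (hS : IsArc S)
    (hm : m = Fintype.card F + 2) (B : Module.Basis (Fin (n + 2)) F (Fin (n + 2) → F))
    {a : Fin n → Fin m} (ha : Function.Injective a) {E : Finset (Fin m)}
    (hE : ∀ e ∈ E, e ∉ Finset.univ.image a) (hEcard : E.card = n + 1) {z : Fin m}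
    (hzE : z ∉ E) (hza : z ∉ Finset.univ.image a) :
    ∑ e ∈ E,
      (∏ u ∈ Finset.univ \ insert e (Finset.univ.image a),
        B.det (Fin.cons (S u) (Fin.cons (S e) (S ∘ a) : Fin (n + 1) → Fin (n + 2) → F)))⁻¹ *
      (∏ u ∈ E.erase e,
        B.det (Fin.cons (S u) (Fin.cons (S e) (S ∘ a) : Fin (n + 1) → Fin (n + 2) → F)))⁻¹ = 0 := by
  let φ : (Fin (n + 2) → F) →ₗ[F] (Fin (n + 2) → F) →ₗ[F] F :=
    LinearMap.mk₂ F (fun u v => (B.det.curryLeft u).curryLeft v (S ∘ a))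
      (by intros; simp) (by intros; simp) (by intros; simp) (by intros; simp)
  have hφ : ∀ u v, φ u v =
      B.det (Fin.cons u (Fin.cons v (S ∘ a) : Fin (n + 1) → Fin (n + 2) → F)) := fun _ _ => rfl
  have hself : ∀ u, φ u u = 0 := fun u => by
    rw [hφ]
    exact B.det.map_eq_zero_of_eq _ (i := 0) (j := 1) rfl (by simp)
  have hanti : ∀ u v, φ u v = - φ v u := fun u v => by
    have := hself (u + v)
    simp only [map_add, LinearMap.add_apply, hself, zero_add, add_zero] at this
    exact eq_neg_of_add_eq_zero_right this
  have hφa : ∀ u j, φ u (S (a j)) = 0 := fun u j => by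
    rw [hφ]
    exact B.det.map_eq_zero_of_eq _ (i := 1) (j := j.succ.succ) rfl
      (by simp [Fin.ext_iff])
  have hinj : ∀ u v : Fin m, u ≠ v → u ∉ Finset.univ.image a → v ∉ Finset.univ.image a →
      Function.Injective (Fin.cons u (Fin.cons v a : Fin (n + 1) → Fin m) :
        Fin (n + 2) → Fin m) := by
    intro u v huv hu hv
    rw [Fin.cons_injective_iff, Fin.cons_injective_iff, Fin.range_cons]
    simp only [Finset.mem_image, Finset.mem_univ, true_and] at hu hv
    exact ⟨by simpa [huv] using hu, by simpa using hv, ha⟩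
  have hcomp : ∀ u v : Fin m, S ∘ (Fin.cons u (Fin.cons v a : Fin (n + 1) → Fin m) :
        Fin (n + 2) → Fin m) =
      Fin.cons (S u) (Fin.cons (S v) (S ∘ a) : Fin (n + 1) → Fin (n + 2) → F) := by
    intro u v
    funext i
    refine Fin.cases rfl (fun i => Fin.cases rfl (fun i => rfl) i) i
  have hne : ∀ u v : Fin m, u ≠ v → u ∉ Finset.univ.image a → v ∉ Finset.univ.image a →
      φ (S u) (S v) ≠ 0 := fun u v huv hu hv => by
    rw [hφ, ← hcomp]
    exact hS.det_ne_zero B (hinj u v huv hu hv)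
  obtain ⟨r, hr⟩ : E.Nonempty := by rw [← Finset.card_pos]; omega
  have hra := hE r hr
  have hrz : r ≠ z := fun h => hzE (h ▸ hr)
  -- Both sides are linear in `v` and agree on the basis formed by `S r`, `S z` and `S ∘ a`.
  have plucker : ∀ u v, φ (S r) (S z) * φ u v =
      φ u (S z) * φ (S r) v + φ (S r) u * φ (S z) v := by
    intro u v
    have hψ : φ (S r) (S z) • φ u - (φ u (S z) • φ (S r) + φ (S r) u • φ (S z)) = 0 := by
      refine LinearMap.ext_on_range (hS.span_range_comp (hinj r z hrz hra hza)).2 fun i => ?_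
      rw [hcomp]
      refine Fin.cases ?_ (fun i => Fin.cases ?_ (fun j => ?_) i) i
      · simp only [Fin.cons_zero, LinearMap.sub_apply, LinearMap.add_apply, LinearMap.smul_apply,
          smul_eq_mul, hself, LinearMap.zero_apply]
        rw [hanti u (S r), hanti (S z) (S r)]
        ring
      · simp only [Fin.cons_zero, Fin.cons_succ, LinearMap.sub_apply, LinearMap.add_apply,
          LinearMap.smul_apply, smul_eq_mul, hself, LinearMap.zero_apply]
        ring
      · simp [hφa]
    have := LinearMap.congr_fun hψ v
    simpa [sub_eq_zero] using this
  have hrz0 := hne r z hrz hra hza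
  let Y : Finset (Fin m) := Finset.univ \ insert z (Finset.univ.image a)
  have hY : ∀ e, e ∈ Y ↔ e ≠ z ∧ e ∉ Finset.univ.image a := fun e => by
    simp only [Y, Finset.mem_sdiff, Finset.mem_univ, true_and, Finset.mem_insert, not_or]
  have hEY : E ⊆ Y := fun e he => (hY e).2 ⟨fun h => hzE (h ▸ he), hE e he⟩
  let s : Fin m → F := fun e => φ (S z) (S e)
  let x : Fin m → F := fun e => φ (S r) (S e) / φ (S z) (S e)
  have hs : ∀ e ∈ Y, s e ≠ 0 := fun e he =>
    hne z e ((hY e).1 he).1.symm hza ((hY e).1 he).2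
  have hform : ∀ u ∈ Y, ∀ e ∈ Y,
      φ (S u) (S e) = (-(φ (S r) (S z))⁻¹) * s u * s e * (x e - x u) := by
    intro u hu e he
    have h1 : φ (S z) (S u) ≠ 0 := hs u hu
    have h2 : φ (S z) (S e) ≠ 0 := hs e he
    have h := plucker (S u) (S e)
    rw [hanti (S u) (S z)] at h
    simp only [s, x]
    field_simp
    linear_combination h
  have hx : Set.InjOn x Y := by
    intro u hu e he hue
    by_contra hne'
    refine hne u e hne' ((hY u).1 hu).2 ((hY e).1 he).2 ?_
    rw [hform u hu e he, hue, sub_self, mul_zero]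
  have hcardY : Y.card + E.card = Fintype.card F + 2 := by
    have : (Finset.univ.image a).card = n := by
      rw [Finset.card_image_of_injective _ ha, Finset.card_univ, Fintype.card_fin]
    have hle := Finset.card_le_univ (insert z (Finset.univ.image a))
    rw [Finset.card_insert_of_notMem hza, this, Fintype.card_fin] at hle
    rw [Finset.card_sdiff_of_subset (Finset.subset_univ _), Finset.card_insert_of_notMem hza, this,
      Finset.card_univ, Fintype.card_fin]
    omega
  rw [← sum_inv_prod_scaled_eq_zero hEY hs hx hcardY]
  refine Finset.sum_congr rfl fun e he => ?_
  -- The factor at `z` is `φ (S z) (S e) = s e`, the isolated `s e` of the scaled identity.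
  have hset : Finset.univ \ insert e (Finset.univ.image a) = insert z (Y.erase e) := by
    ext w
    simp only [Finset.mem_sdiff, Finset.mem_univ, true_and, Finset.mem_insert, not_or,
      Finset.mem_erase, hY]
    by_cases hw : w = z
    · subst hw
      have hwe : w ≠ e := fun h => hzE (h ▸ he)
      simpa [hwe] using hza
    · tauto
  rw [hset, Finset.prod_insert (by simp [Y])]
  congr 2
  · congr 1
    refine Finset.prod_congr rfl fun u hu => ?_
    rw [← hform u (Finset.mem_of_mem_erase hu) e (hEY he)]
    rfl
  · refine Finset.prod_congr rfl fun u hu => ?_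
    rw [← hform u (hEY (Finset.mem_of_mem_erase hu)) e (hEY he)]
    rfl

end Tangents

/-! ### No arc of size `q + 2`; an arc of size `q + 1`. -/

section MaximalArcs

variable {F : Type*} [Field F] [Fintype F]

theorem not_isArc_of_card_add_two {p n : ℕ} [CharP F p] (hnp : n + 2 ≤ 2 * p - 2)
    (hle : 2 * (n + 2) - 2 ≤ Fintype.card F + 2)
    (S : Fin (Fintype.card F + 2) → Fin (n + 2) → F) : ¬ IsArc S := by
  intro hS
  let ι : Fin (2 * (n + 2) - 2) → Fin (Fintype.card F + 2) := Fin.castLE hle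
  have hι : Function.Injective ι := Fin.castLE_injective hle
  let B : Module.Basis (Fin (n + 2)) F (Fin (n + 2) → F) := Pi.basisFun F _
  have hG : IsArc (S ∘ ι) := hS.comp (by omega) hι
  let d : (Fin (n + 2) → F) → ArcRow (2 * (n + 2) - 2) (n + 2) → F := arcDet (S ∘ ι) B
  let β : ArcRow (2 * (n + 2) - 2) (n + 2) → F := fun C =>
    (∏ u ∈ Finset.univ \ C.1.image ι, d (S u) C)⁻¹ *
      (∏ u ∈ Finset.univ \ C.1, d (S (ι u)) C)⁻¹
  have hd : ∀ C u, u ∉ C.1.image ι → d (S u) C ≠ 0 := fun C u hu =>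
    hS.arcDet_ne_zero hι B C fun c hc h => hu (h ▸ Finset.mem_image_of_mem ι hc)
  have hdι : ∀ (C : ArcRow (2 * (n + 2) - 2) (n + 2)) u, u ∉ C.1 → d (S (ι u)) C ≠ 0 :=
    fun C u hu => hd C _ (by simpa [hι.eq_iff] using hu)
  have hβ : Matrix.vecMul β (arcMatrix (S ∘ ι) B 1) = 0 := by
    funext ⟨⟨U, A⟩, hU, hA, hUA⟩
    obtain ⟨z, rfl⟩ := Finset.card_eq_one.1 hU
    have hA' : A.card = n := Nat.succ_injective (Nat.succ_injective hA)
    have hzA : z ∉ A := by simpa using hUA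
    let f : Finset (Fin (2 * (n + 2) - 2)) → F := fun C =>
      if h : C.card + 1 = n + 2 then β ⟨C, h⟩ * d (S (ι z)) ⟨C, h⟩ else 0
    have hf : ∀ C : ArcRow (2 * (n + 2) - 2) (n + 2), f C.1 = β C * d (S (ι z)) C :=
      fun C => dif_pos C.2
    have hrow : Matrix.vecMul β (arcMatrix (S ∘ ι) B 1) ⟨({z}, A), hU, hA, hUA⟩ =
        ∑ e ∈ Finset.univ \ ({z} ∪ A), f (insert e A) := by
      rw [← sum_arcRow_eq f hA hUA, Matrix.vecMul, dotProduct]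
      refine Finset.sum_congr rfl fun C _ => ?_
      simp only [arcMatrix, Matrix.of_apply, Finset.prod_singleton, mul_ite, mul_zero, hf]
      rfl
    -- For `C = insert e A`, the complement of `C` in the subarc is `z` together with `E.erase e`.
    -- The factor at `z` in `β C` cancels the matrix entry, leaving the summand of the determinant
    -- identity.
    let E := Finset.univ \ ({z} ∪ A)
    have hE : ∀ e, e ∈ E ↔ e ≠ z ∧ e ∉ A := fun e => by simp [E]
    have hEcard : E.card = n + 1 := by
      rw [Finset.card_sdiff_of_subset (Finset.subset_univ _), Finset.card_union_of_disjoint hUA,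
        Finset.card_univ, Fintype.card_fin, hA', Finset.card_singleton]
      omega
    let a : Fin n → Fin (2 * (n + 2) - 2) := A.orderEmbOfFin hA'
    have ha : Function.Injective a := RelEmbedding.injective _
    have haA : Finset.univ.image (ι ∘ a) = A.image ι := by
      rw [← Finset.image_image]
      congr 1
      exact Finset.image_orderEmbOfFin_univ A hA'
    have key := hS.sum_inv_prod_det_eq_zero rfl B (hι.comp ha) (E := E.image ι) (z := ι z)
      (by
        intro _ h
        obtain ⟨e, he, rfl⟩ := Finset.mem_image.1 h
        rw [haA]
        simpa [hι.eq_iff] using ((hE e).1 he).2)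
      (by rw [Finset.card_image_of_injective _ hι, hEcard])
      (by simp [hι.eq_iff, hE]) (by rw [haA]; simpa [hι.eq_iff] using hzA)
    rw [Finset.sum_image hι.injOn, haA] at key
    rw [hrow, Pi.zero_apply, ← key]
    refine Finset.sum_congr rfl fun e he => ?_
    obtain ⟨hez, heA⟩ := (hE e).1 he
    have hC : (insert e A).card + 1 = n + 2 := by
      rw [Finset.card_insert_of_notMem heA, hA']
    let C : ArcRow (2 * (n + 2) - 2) (n + 2) := ⟨insert e A, hC⟩
    obtain ⟨ε, hε, hdet⟩ := exists_sign_arcDet (S ∘ ι) B C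
      (f := (Fin.cons e a : Fin (n + 1) → Fin (2 * (n + 2) - 2)))
      (by
        rw [Fin.cons_injective_iff]
        refine ⟨?_, ha⟩
        rintro ⟨j, hj⟩
        exact heA (hj ▸ Finset.orderEmbOfFin_mem A hA' j))
      (by
        refine Fin.cases (Finset.mem_insert_self e A) fun j => ?_
        exact Finset.mem_insert_of_mem (Finset.orderEmbOfFin_mem A hA' j))
    have hcons : ((S ∘ ι) ∘ (Fin.cons e a : Fin (n + 1) → Fin (2 * (n + 2) - 2))) =
        (Fin.cons (S (ι e)) (S ∘ ι ∘ a) : Fin (n + 1) → Fin (n + 2) → F) := by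
      funext i
      exact Fin.cases rfl (fun j => rfl) i
    rw [hcons] at hdet
    have hEe : Finset.univ \ C.1 = insert z (E.erase e) := by
      ext w
      simp only [C, Finset.mem_sdiff, Finset.mem_univ, true_and, Finset.mem_insert, not_or,
        Finset.mem_erase, hE]
      by_cases hw : w = z
      · subst hw
        simp [hzA, Ne.symm hez]
      · tauto
    have himage : C.1.image ι = insert (ι e) (A.image ι) := Finset.image_insert ι e A
    have hzC : d (S (ι z)) C ≠ 0 := hdι C z (by simp [C, hzA, Ne.symm hez])
    have hcard : (Finset.univ \ insert (ι e) (A.image ι)).card + (E.erase e).card =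
        Fintype.card F + 1 := by
      rw [← himage, Finset.card_sdiff_of_subset (Finset.subset_univ _),
        Finset.card_image_of_injective _ hι, Finset.card_univ, Fintype.card_fin,
        Finset.card_erase_of_mem he, hEcard, show C.1.card = n + 1 from Nat.succ_injective hC]
      omega
    -- Reordering `C` costs `ε` in each of `q + 1` factors, and `ε ^ (q + 1) = ε ^ 2 = 1`.
    have hsign : ε ^ (Finset.univ \ insert (ι e) (A.image ι)).card * ε ^ (E.erase e).card = 1 := by
      rw [← pow_add, hcard, pow_succ, FiniteField.pow_card ε, ← sq, hε]
    rw [← Finset.image_erase hι, Finset.prod_image hι.injOn]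
    simp only [hdet, Finset.prod_mul_distrib, Finset.prod_const]
    rw [hf C]
    simp only [β]
    rw [hEe, Finset.prod_insert (by simp [hE]), himage]
    change _ * (d (S (ι z)) C * _)⁻¹ * d (S (ι z)) C = _
    rw [mul_inv (d _ _), mul_assoc, mul_comm (d _ _)⁻¹, inv_mul_cancel_right₀ hzC, ← mul_inv,
      ← mul_inv, mul_mul_mul_comm, hsign, one_mul]
  have hzero := hG.vecMul_arcMatrix_eq_zero hnp B β hβ
  obtain ⟨C, -, hC⟩ := Finset.exists_subset_card_eq
    (show n + 1 ≤ (Finset.univ : Finset (Fin (2 * (n + 2) - 2))).card by simp; omega)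
  have hβC := congrFun hzero ⟨C, by omega⟩
  refine mul_ne_zero (inv_ne_zero (Finset.prod_ne_zero_iff.2 fun u hu => ?_))
    (inv_ne_zero (Finset.prod_ne_zero_iff.2 fun u hu => ?_)) hβC
  · exact hd _ u (Finset.mem_sdiff.1 hu).2
  · exact hdι _ u (Finset.mem_sdiff.1 hu).2

/-- The normal rational curve is an arc of size `q + 1`. -/
theorem card_add_one_mem_arcSizes {k : ℕ} (hk : k ≤ Fintype.card F + 1) :
    Fintype.card F + 1 ∈ arcSizes F k := by
  classical
  obtain ⟨e⟩ : Nonempty (Fin (Fintype.card F + 1) ≃ Option F) :=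
    ⟨Fintype.equivOfCardEq (by simp)⟩
  -- Homogeneous coordinates `(v : w)` on the projective line: `none` is the point `(1 : 0)` at
  -- infinity, `some a` is `(a : 1)`.
  let v : Fin (Fintype.card F + 1) → F := fun i => (e i).elim 1 id
  let w : Fin (Fintype.card F + 1) → F := fun i => (e i).elim 0 fun _ => 1
  have hvw : ∀ i j, i ≠ j → v j * w i - v i * w j ≠ 0 := by
    intro i j hij
    have : e i ≠ e j := fun h => hij (e.injective h)
    rcases hi : e i with _ | a <;> rcases hj : e j with _ | b
    · exact absurd (hi.trans hj.symm) this
    · simp [v, w, hi, hj]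
    · simp [v, w, hi, hj]
    · rw [hi, hj] at this
      simpa [v, w, hi, hj, sub_eq_zero, eq_comm] using this
  refine ⟨Matrix.rectVandermonde v w k, hk, fun s hs => ?_⟩
  have hdet : IsUnit (Matrix.projVandermonde (v ∘ s.orderEmbOfFin hs) (w ∘ s.orderEmbOfFin hs)) := by
    rw [Matrix.isUnit_iff_isUnit_det, isUnit_iff_ne_zero, Matrix.det_projVandermonde]
    refine Finset.prod_ne_zero_iff.2 fun i _ => Finset.prod_ne_zero_iff.2 fun j hj => hvw _ _ ?_
    exact fun h => (Finset.mem_Ioi.1 hj).ne (RelEmbedding.injective _ h)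
  have hrow := Matrix.linearIndependent_rows_iff_isUnit.2 hdet
  have hli : LinearIndependent F (fun i : s => Matrix.rectVandermonde v w k i) := by
    refine (linearIndependent_equiv (s.orderIsoOfFin hs).toEquiv).1 ?_
    exact hrow
  exact ⟨hli, hli.span_eq_top_of_card_eq_finrank' (by simp [hs])⟩

end MaximalArcs

/-! ### The main theorem. -/

theorem mainTheorem3 {F : Type*} [Field F] [Fintype F] (p q k : ℕ) [CharP F p]
    (hq : Fintype.card F = q) (hk : 2 ≤ k) (hkp : k ≤ 2 * p - 2) :
    (2 * p - 2 ≤ q →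
      ∀ G : Fin (2 * k - 2) → (Fin k → F), IsArc G →
        ∀ B : Module.Basis (Fin k) F (Fin k → F),
          (arcMatrix G B 1).rank = Fintype.card (ArcRow (2 * k - 2) k)) ∧
    (¬ q.Prime → IsGreatest (arcSizes F k) (q + 1)) := by
  obtain ⟨n, rfl⟩ : ∃ n, k = n + 2 := ⟨k - 2, by omega⟩
  refine ⟨fun _ G hG B => ?_, fun hprime => ?_⟩
  · refine LinearIndependent.rank_matrix (Matrix.vecMul_injective_iff.1 fun β γ h => ?_)
    rw [← sub_eq_zero] at h ⊢
    exact hG.vecMul_arcMatrix_eq_zero hkp B _ (by rw [Matrix.sub_vecMul]; exact h)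
  · subst hq
    have hsq : p ^ 2 ≤ Fintype.card F := by
      obtain ⟨h, hp, hcard⟩ := FiniteField.card F p
      rw [hcard]
      refine Nat.pow_le_pow_right hp.pos ?_
      by_contra! hlt
      have h1 : (h : ℕ) = 1 := le_antisymm (by omega) h.pos
      exact hprime (by rw [hcard, h1, pow_one]; exact hp)
    -- With `p ^ 2 ≤ q` this yields `2k - 2 ≤ 4p - 6 ≤ q + 2`, so an arc of size `q + 2` contains a
    -- subarc of size `2k - 2`.
    have hbound : 4 * p ≤ p ^ 2 + 4 := by
      zify
      nlinarith [sq_nonneg ((p : ℤ) - 2)]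
    refine ⟨card_add_one_mem_arcSizes (by omega), fun m hm => ?_⟩
    obtain ⟨S, hS⟩ := hm
    by_contra! hlt
    exact not_isArc_of_card_add_two (p := p) hkp (by omega) _
      (hS.comp (by omega) (Fin.castLE_injective (show Fintype.card F + 2 ≤ m by omega)))
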